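/- Let $d\ge 1$, $L\ge 2$ and $N_1,\dots,N_{L-1}\ge 1$ be integers, and put $S=(d,N_1,\dots,N_{L-1},1)$, $N_0=d$, $N_L=1$. Let $\Omega\subset\mathbb{R}^d$ be compact, and let $C(\Omega)$ be the space of continuous functions $\Omega\to\mathbb{R}$ with the supremum norm. Let $\varrho:\mathbb{R}\to\mathbb{R}$ be continuous and not a polynomial, and suppose that there is some $x_0\in\mathbb{R}$ at which $\varrho$ is differentiable with $\varrho'(x_0)\neq 0$. Let $\mathcal{RNN}_\varrho^\Omega(S)\subset C(\Omega)$ be the set of all functions $\Omega\to\mathbb{R}$, $x\mapsto x_L$, given by $$x_0:=x,\qquad x_\ell:=\varrho(A_\ell x_{\ell-1}+b_\ell)\quad(1\le \ell\le L-1),\qquad x_L:=A_Lx_{L-1}+b_L,$$ where $A_\ell\in\mathbb{R}^{N_\ell\times N_{\ell-1}}$ and $b_\ell\in\mathbb{R}^{N_\ell}$ $(1\le \ell\le L)$ are arbitrary and $\varrho$ acts componentwise. For $\varepsilon>0$, a subset $A$ of a normed vector space is called $\varepsilon$-convex if $\mathrm{co}(A)\subset A+B_\varepsilon(0)$, where $\mathrm{co}(A)$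 is the convex hull of $A$ and $B_\varepsilon(0)$ is the open ball of radius $\varepsilon$ around $0$. If $\mathcal{RNN}_\varrho^\Omega(S)$ is not dense in $C(\Omega)$, then there is no $\varepsilon>0$ such that the closure of $\mathcal{RNN}_\varrho^\Omega(S)$ in $C(\Omega)$ is $\varepsilon$-convex in $(C(\Omega),\|\cdot\|_{\sup})$. -/

import Mathlib

open scoped Pointwise Polynomial

/-- `NeuralNetwork d N m` is the type of neural networks with input dimension `d`, hidden layer
widths `N = [N₁, …, N_{L-1}]` and output dimension `m`, so with architecture
`(d, N₁, …, N_{L-1}, m)` and `L = N.length + 1` layers. Such a network is a family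
`((A₁, b₁), …, (A_L, b_L))` of matrix-vector tuples of matching sizes: `layer A b Φ` puts
`(A, b)` in front of the tuples of `Φ`, and `output A b` is the family with the one tuple
`(A, b)`. -/
inductive NeuralNetwork : ℕ → List ℕ → ℕ → Type
  | output {d m : ℕ} (A : Matrix (Fin m) (Fin d) ℝ) (b : Fin m → ℝ) : NeuralNetwork d [] m
  | layer {d n : ℕ} {N : List ℕ} {m : ℕ} (A : Matrix (Fin n) (Fin d) ℝ) (b : Fin n → ℝ)
      (Φ : NeuralNetwork n N m) : NeuralNetwork d (n :: N) m

/-- The function computed by a network on all of `ℝ^d`: the map `x₀ ↦ x_L`, where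
`x_ℓ = ρ (A_ℓ x_{ℓ-1} + b_ℓ)` for `ℓ = 1, …, L - 1` with `ρ` acting componentwise, and
`x_L = A_L x_{L-1} + b_L`. -/
noncomputable def NeuralNetwork.realization (ρ : ℝ → ℝ) :
    {d : ℕ} → {N : List ℕ} → {m : ℕ} → NeuralNetwork d N m → (Fin d → ℝ) → (Fin m → ℝ)
  | _, _, _, .output A b, x => A.mulVec x + b
  | _, _, _, .layer A b Φ, x => Φ.realization ρ (fun i => ρ ((A.mulVec x + b) i))

/-- The set of restrictions to `Ω` of the realizations of networks with architecture
`(d, N₁, …, N_{L-1}, 1)`, as a subset of `C(Ω)`. The only component of the output in `ℝ^1` is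
identified with a real number. For continuous `ρ` every realization is continuous, so that each
network contributes an element. -/
def realizationSet (ρ : ℝ → ℝ) {d : ℕ} (N : List ℕ) (Ω : Set (Fin d → ℝ)) : Set C(Ω, ℝ) :=
  {f | ∃ Φ : NeuralNetwork d N 1, ∀ x : Ω, f x = Φ.realization ρ (x : Fin d → ℝ) 0}

/-- A subset `A` of a normed space is `ε`-convex if `co(A) ⊆ A + B_ε(0)`, with the open ball. -/
def IsEpsConvex {Y : Type*} [NormedAddCommGroup Y] [NormedSpace ℝ Y] (ε : ℝ) (A : Set Y) : Prop :=
  convexHull ℝ A ⊆ A + Metric.ball (0 : Y) ε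

/-! The closure of the network set is stable under scalars. If it were `ε`-convex, rescaling would
make the error `ε` negligible, so it would be a closed subspace (`IsEpsConvex.add_mem`). It contains
every ridge function `ρ (w ⬝ᵥ x + b)`: the first layer computes it, and the later layers pass it on
approximately, since difference quotients of `ρ` at `x₀` approximate a nonzero multiple of the
identity.

A closed subspace containing all ridge functions is everything (`eq_top_of_ridge_mem`): some
mollification of `ρ` has a nonzero `k`-th derivative, so differentiating in the weight produces the
powers of `w ⬝ᵥ x`, hence their exponentials, and Stone–Weierstrass applies. This contradicts
non-density. -/

/-! ### Recognizing polynomials -/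

open Filter Topology MeasureTheory Polynomial in
/-- A smooth function whose `k`-th derivative vanishes is a polynomial of degree less than `k`. -/
theorem exists_polynomial_of_iteratedDeriv_eq_zero (k : ℕ) :
    ∀ {σ : ℝ → ℝ}, ContDiff ℝ (⊤ : ℕ∞) σ → (∀ x, iteratedDeriv k σ x = 0) →
      ∃ p : ℝ[X], p.degree < k ∧ ∀ x, σ x = p.eval x := by
  induction k with
  | zero =>
    intro σ _ h
    exact ⟨0, by simp, fun x => by simpa using h x⟩
  | succ k ih =>
    intro σ hσ h
    have hσ' : ContDiff ℝ (⊤ : ℕ∞) (deriv σ) := (contDiff_infty_iff_deriv.1 hσ).2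
    obtain ⟨p, hp, hpσ⟩ := ih hσ' fun x => by rw [← iteratedDeriv_succ']; exact h x
    let q : ℝ[X] := ∑ i ∈ Finset.range k, C (p.coeff i / (i + 1)) * X ^ (i + 1)
    have hq : ∀ x, q.derivative.eval x = p.eval x := by
      intro x
      rw [eval_eq_sum_degreeLTEquiv (mem_degreeLT.2 hp)]
      simp only [q, derivative_sum, eval_finsetSum, ← Fin.sum_univ_eq_sum_range]
      refine Finset.sum_congr rfl fun i _ => ?_
      have : ((i : ℕ) : ℝ) + 1 ≠ 0 := by positivity
      simp [degreeLTEquiv]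
      field_simp
    have hqd : q.degree < (k + 1 : ℕ) := by
      refine (degree_sum_le _ _).trans_lt ((Finset.sup_lt_iff (WithBot.bot_lt_coe _)).2 fun i hi => ?_)
      refine (degree_C_mul_X_pow_le _ _).trans_lt ?_
      exact_mod_cast Nat.succ_lt_succ (Finset.mem_range.1 hi)
    have hdiff : Differentiable ℝ σ := hσ.differentiable (by simp)
    have hconst : ∀ x y, σ x - q.eval x = σ y - q.eval y := by
      refine is_const_of_deriv_eq_zero (f := fun x => σ x - q.eval x) (hdiff.sub q.differentiable) ?_
      intro x
      rw [deriv_fun_sub (hdiff x) q.differentiableAt, Polynomial.deriv, hq, hpσ, sub_self]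
    refine ⟨q + C (σ 0 - q.eval 0), (degree_add_le _ _).trans_lt (max_lt hqd ?_), fun x => ?_⟩
    · exact degree_C_le.trans_lt (by exact_mod_cast Nat.succ_pos k)
    · have := hconst x 0
      simp only [eval_add, eval_C]
      linarith

open Filter Topology Polynomial in
/-- A pointwise limit of polynomials of degree less than `k` is a polynomial. -/
theorem exists_polynomial_of_tendsto {ι : Type*} {l : Filter ι} [l.NeBot] (k : ℕ) {ρ : ℝ → ℝ}
    {p : ι → ℝ[X]} (hp : ∀ i, (p i).degree < k)
    (h : ∀ x, Tendsto (fun i => (p i).eval x) l (𝓝 (ρ x))) :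
    ∃ q : ℝ[X], ∀ x, ρ x = q.eval x := by
  have hinj : Set.InjOn (fun n : ℕ => (n : ℝ)) (Finset.range k : Set ℕ) :=
    Nat.cast_injective.injOn
  -- Interpolation at `0, …, k - 1` recovers each `p i` from `k` values, so it survives the
  -- pointwise limit.
  refine ⟨Lagrange.interpolate (Finset.range k) (fun n : ℕ => (n : ℝ)) fun n => ρ n, fun x => ?_⟩
  refine tendsto_nhds_unique (h x) ?_
  have key : ∀ i, (p i).eval x = ∑ n ∈ Finset.range k, (p i).eval (n : ℝ) *
      (Lagrange.basis (Finset.range k) (fun n : ℕ => (n : ℝ)) n).eval x := by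
    intro i
    conv_lhs => rw [Lagrange.eq_interpolate (f := p i) hinj (by simpa using hp i)]
    simp [Lagrange.interpolate_apply, eval_finsetSum]
  simp only [key, Lagrange.interpolate_apply, eval_finsetSum, eval_mul, eval_C]
  exact tendsto_finsetSum _ fun n _ => (h n).mul_const _

/-! ### Calculus in closed subspaces -/

/-- A closed submodule contains the derivatives of the curves that run in it. -/
theorem Submodule.mem_of_hasDerivAt {E : Type*} [NormedAddCommGroup E] [NormedSpace ℝ E]
    {M : Submodule ℝ E} (hM : IsClosed (M : Set E)) {γ : ℝ → E} {γ' : E} {t : ℝ}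
    (h : HasDerivAt γ γ' t) (hγ : ∀ s, γ s ∈ M) : γ' ∈ M :=
  hM.mem_of_tendsto (hasDerivAt_iff_tendsto_slope.1 h)
    (Filter.Eventually.of_forall fun s => M.smul_mem _ (M.sub_mem (hγ s) (hγ t)))

open MeasureTheory in
/-- A closed submodule of a Banach space contains the integrals of the continuous compactly
supported functions with values in it. -/
theorem Submodule.integral_mem_of_hasCompactSupport {E : Type*} [NormedAddCommGroup E]
    [NormedSpace ℝ E] [CompleteSpace E] {M : Submodule ℝ E} (hM : IsClosed (M : Set E))
    {f : ℝ → E} (hf : Continuous f) (hs : HasCompactSupport f) (hfM : ∀ t, f t ∈ M) :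
    ∫ t, f t ∈ M := by
  have : CompleteSpace M := hM.completeSpace_coe
  let g : ℝ → M := fun t => ⟨f t, hfM t⟩
  have hg : Continuous g := hf.subtype_mk _
  have hgs : HasCompactSupport g := by
    refine hs.mono fun t ht => ?_
    intro h0
    exact ht (Subtype.ext h0)
  have := M.subtypeL.integral_comp_comm (hg.integrable_of_hasCompactSupport hgs (μ := volume))
  change ∫ t, M.subtypeL (g t) ∈ M
  rw [this]
  exact (∫ t, g t).2

/-! ### From one activation function to powers and exponentials -/

section RidgeFunctions

variable {X : Type*} [TopologicalSpace X]

/-- The function `x ↦ ρ (a * g x + b)`. -/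
def affineComp (ρ : C(ℝ, ℝ)) (g : C(X, ℝ)) (a b : ℝ) : C(X, ℝ) :=
  ρ.comp (a • g + ContinuousMap.const X b)

theorem affineComp_apply (ρ : C(ℝ, ℝ)) (g : C(X, ℝ)) (a b : ℝ) (x : X) :
    affineComp ρ g a b x = ρ (a * g x + b) := rfl

theorem continuous_affineComp {Y : Type*} [TopologicalSpace Y] (ρ : C(ℝ, ℝ)) (g : C(X, ℝ))
    {a b : Y → ℝ} (ha : Continuous a) (hb : Continuous b) :
    Continuous fun y => affineComp ρ g (a y) (b y) := by
  refine ContinuousMap.continuous_of_continuous_uncurry _ ?_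
  simp only [Function.uncurry_def, affineComp_apply]
  fun_prop

variable [CompactSpace X]

-- Differentiability in the supremum norm comes from writing the curve as a `C(X)`-valued integral,
-- an identity that can be checked pointwise.
open MeasureTheory in
theorem hasDerivAt_mul_affineComp {σ σ' : C(ℝ, ℝ)} (hσ : ∀ x, HasDerivAt σ (σ' x) x)
    (u g : C(X, ℝ)) (a b : ℝ) :
    HasDerivAt (fun s => u * affineComp σ g s b) (u * g * affineComp σ' g a b) a := by
  have hcont : Continuous fun s => u * g * affineComp σ' g s b :=
    continuous_const.mul (continuous_affineComp σ' g continuous_id continuous_const)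
  have heq : (fun s => u * affineComp σ g s b) = fun s =>
      u * affineComp σ g 0 b + ∫ t in (0 : ℝ)..s, u * g * affineComp σ' g t b := by
    funext s
    ext x
    have h1 := (ContinuousMap.evalCLM ℝ x).intervalIntegral_comp_comm
      (hcont.intervalIntegrable (μ := volume) 0 s)
    simp only [ContinuousMap.evalCLM_apply] at h1
    have h2 : ∀ t, HasDerivAt (fun t => u x * σ (t * g x + b))
        ((u * g * affineComp σ' g t b) x) t := by
      intro t
      have := ((hσ (t * g x + b)).comp t (((hasDerivAt_id t).mul_const (g x)).add_const b)).const_mul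
        (u x)
      refine this.congr_deriv ?_
      simp only [ContinuousMap.mul_apply, affineComp_apply]
      ring
    rw [ContinuousMap.add_apply, ← h1, intervalIntegral.integral_eq_sub_of_hasDerivAt
      (fun t _ => h2 t) (Continuous.intervalIntegrable
        ((ContinuousMap.evalCLM ℝ x).continuous.comp hcont) _ _)]
    simp [affineComp_apply]
  rw [heq]
  exact (hcont.integral_hasStrictDerivAt 0 a).hasDerivAt.const_add _

/-- If a closed submodule of `C(X)` contains the functions `σ (a * g + b)` for a smooth `σ` whose
`k`-th derivative is not identically zero, then it contains `g ^ k`. -/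
theorem pow_mem_of_affineComp_mem {M : Submodule ℝ C(X, ℝ)} (hM : IsClosed (M : Set C(X, ℝ)))
    {σ : C(ℝ, ℝ)} (hσ : ContDiff ℝ (⊤ : ℕ∞) σ) {g : C(X, ℝ)} (h : ∀ a b, affineComp σ g a b ∈ M)
    {k : ℕ} {b : ℝ} (hk : iteratedDeriv k σ b ≠ 0) : g ^ k ∈ M := by
  have hcont : ∀ k, Continuous (iteratedDeriv k σ) := fun k =>
    hσ.continuous_iteratedDeriv k (by exact_mod_cast le_top)
  have hmem : ∀ (k : ℕ) (a b : ℝ), g ^ k * affineComp ⟨iteratedDeriv k σ, hcont k⟩ g a b ∈ M := by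
    intro k
    induction k with
    | zero =>
      intro a b
      convert h a b using 1
      ext x
      simp [affineComp_apply]
    | succ k ih =>
      intro a b
      rw [pow_succ]
      refine Submodule.mem_of_hasDerivAt hM
        (hasDerivAt_mul_affineComp (σ := ⟨iteratedDeriv k σ, hcont k⟩) (fun x => ?_) (g ^ k) g a b)
        fun s => ih s b
      simp only [ContinuousMap.coe_mk, iteratedDeriv_succ]
      exact (hσ.differentiable_iteratedDeriv k (by exact_mod_cast ENat.natCast_lt_top k) x).hasDerivAt
  -- At weight `0` the second factor is the nonzero constant `iteratedDeriv k σ b`.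
  have := M.smul_mem (iteratedDeriv k σ b)⁻¹ (hmem k 0 b)
  convert this using 1
  ext x
  simp only [ContinuousMap.smul_apply, ContinuousMap.mul_apply, affineComp_apply,
    ContinuousMap.coe_mk, zero_mul, zero_add, smul_eq_mul]
  field_simp

-- Convolving superposes the translates `ρ (a * g + b - t)` with weights `φ t`, all of which lie in
-- `M`.
open MeasureTheory Convolution in
theorem affineComp_convolution_mem {M : Submodule ℝ C(X, ℝ)} (hM : IsClosed (M : Set C(X, ℝ)))
    {ρ σ : C(ℝ, ℝ)} {φ : ℝ → ℝ} (hφ : Continuous φ) (hφs : HasCompactSupport φ)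
    (hσ : ⇑σ = φ ⋆[ContinuousLinearMap.lsmul ℝ ℝ, volume] ρ) {g : C(X, ℝ)}
    (h : ∀ a b, affineComp ρ g a b ∈ M) (a b : ℝ) : affineComp σ g a b ∈ M := by
  have hc : Continuous fun t => φ t • affineComp ρ g a (b - t) :=
    hφ.smul (continuous_affineComp ρ g continuous_const (by fun_prop))
  have hs : HasCompactSupport fun t => φ t • affineComp ρ g a (b - t) := hφs.smul_right
  have heq : affineComp σ g a b = ∫ t, φ t • affineComp ρ g a (b - t) := by
    ext x
    have := (ContinuousMap.evalCLM ℝ x).integral_comp_comm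
      (hc.integrable_of_hasCompactSupport hs (μ := volume))
    simp only [ContinuousMap.evalCLM_apply] at this
    rw [← this, affineComp_apply, hσ, convolution_def]
    simp [affineComp_apply, add_sub_assoc]
  rw [heq]
  exact Submodule.integral_mem_of_hasCompactSupport hM hc hs fun t => M.smul_mem _ (h _ _)

open MeasureTheory Convolution Filter Topology Polynomial in
/-- If a closed submodule of `C(X)` contains the functions `ρ (a * g + b)` for a `ρ` that is not a
polynomial, then it contains the powers of `g`. -/
theorem pow_mem_of_not_polynomial {M : Submodule ℝ C(X, ℝ)} (hM : IsClosed (M : Set C(X, ℝ)))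
    {ρ : C(ℝ, ℝ)} (hρ : ¬ ∃ p : ℝ[X], ∀ x, ρ x = p.eval x) {g : C(X, ℝ)}
    (h : ∀ a b, affineComp ρ g a b ∈ M) (k : ℕ) : g ^ k ∈ M := by
  by_contra hk
  let φ : ℕ → ContDiffBump (0 : ℝ) := fun n =>
    ⟨1 / ((n : ℝ) + 1) / 2, 1 / ((n : ℝ) + 1), by positivity, half_lt_self (by positivity)⟩
  let σ : ℕ → ℝ → ℝ := fun n =>
    (φ n).normed volume ⋆[ContinuousLinearMap.lsmul ℝ ℝ, volume] ρ
  have hσ : ∀ n, ContDiff ℝ (⊤ : ℕ∞) (σ n) := fun n =>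
    (φ n).hasCompactSupport_normed.contDiff_convolution_left _ (φ n).contDiff_normed
      ρ.continuous.locallyIntegrable
  -- The degree bound `k` is the same for all mollifications, as the passage to the limit requires.
  have hpol : ∀ n, ∃ p : ℝ[X], p.degree < k ∧ ∀ x, σ n x = p.eval x := by
    refine fun n => exists_polynomial_of_iteratedDeriv_eq_zero k (hσ n) fun x => ?_
    by_contra hx
    exact hk (pow_mem_of_affineComp_mem hM (σ := ⟨σ n, (hσ n).continuous⟩) (hσ n)
      (affineComp_convolution_mem hM (φ n).continuous_normed (φ n).hasCompactSupport_normed rfl h)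
      hx)
  choose p hp hpσ using hpol
  refine hρ (exists_polynomial_of_tendsto (l := atTop) k hp fun x => ?_)
  simp only [← hpσ]
  exact ContDiffBump.convolution_tendsto_right_of_continuous
    tendsto_one_div_add_atTop_nhds_zero_nat ρ.continuous x

theorem exp_mem_of_pow_mem {M : Submodule ℝ C(X, ℝ)} (hM : IsClosed (M : Set C(X, ℝ)))
    {g : C(X, ℝ)} (h : ∀ k : ℕ, g ^ k ∈ M) : NormedSpace.exp g ∈ M :=
  hM.mem_of_tendsto (NormedSpace.exp_series_hasSum_exp' (𝕂 := ℝ) g)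
    (Filter.Eventually.of_forall fun _ => M.sum_mem fun k _ => M.smul_mem _ (h k))

end RidgeFunctions

/-! ### Density of ridge functions -/

/-- A closed submodule of `C(X)` that contains the exponentials of the functions of an additive
subgroup separating the points of `X` is everything. -/
theorem eq_top_of_exp_mem {X : Type*} [TopologicalSpace X] [CompactSpace X]
    {M : Submodule ℝ C(X, ℝ)} (hM : IsClosed (M : Set C(X, ℝ))) (G : AddSubgroup C(X, ℝ))
    (hG : ∀ x y, x ≠ y → ∃ g ∈ G, g x ≠ g y) (h : ∀ g ∈ G, NormedSpace.exp g ∈ M) : M = ⊤ := by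
  let S : Submonoid C(X, ℝ) :=
    { carrier := {f | ∃ g ∈ G, NormedSpace.exp g = f}
      one_mem' := ⟨0, G.zero_mem, NormedSpace.exp_zero⟩
      mul_mem' := by
        rintro _ _ ⟨g, hg, rfl⟩ ⟨g', hg', rfl⟩
        exact ⟨g + g', G.add_mem hg hg', NormedSpace.exp_add⟩ }
  let A : Subalgebra ℝ C(X, ℝ) := Algebra.adjoin ℝ (S : Set C(X, ℝ))
  have hexp : ∀ (g : C(X, ℝ)) (x : X), NormedSpace.exp g x = Real.exp (g x) := by
    intro g x
    rw [Real.exp_eq_exp_ℝ]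
    exact NormedSpace.map_exp (ContinuousMap.evalAlgHom ℝ ℝ x) (ContinuousMap.evalCLM ℝ x).continuous g
  have hA : A.SeparatesPoints := by
    intro x y hxy
    obtain ⟨g, hg, hne⟩ := hG x y hxy
    refine ⟨_, ⟨NormedSpace.exp g, Algebra.subset_adjoin ⟨g, hg, rfl⟩, rfl⟩, ?_⟩
    simpa [hexp] using hne
  have hAM : (A : Set C(X, ℝ)) ⊆ M := by
    have : Subalgebra.toSubmodule A ≤ M := by
      -- Exponentials are closed under products, so the algebra they generate is only their linear
      -- span.
      rw [Algebra.adjoin_eq_span, Submonoid.closure_eq, Submodule.span_le]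
      rintro _ ⟨g, hg, rfl⟩
      exact h g hg
    exact this
  refine eq_top_iff.2 fun f _ => ?_
  have := ContinuousMap.continuousMap_mem_subalgebra_closure_of_separatesPoints A hA f
  exact closure_minimal hAM hM this

/-- A closed submodule of `C(Ω)` that contains the ridge functions is everything: universal approximation by shallow
networks with a continuous activation function that is not a polynomial. -/
theorem eq_top_of_ridge_mem {d : ℕ} {Ω : Set (Fin d → ℝ)} [CompactSpace Ω]
    {M : Submodule ℝ C(Ω, ℝ)} (hM : IsClosed (M : Set C(Ω, ℝ))) {ρ : C(ℝ, ℝ)}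
    (hρ : ¬ ∃ p : ℝ[X], ∀ x, ρ x = p.eval x)
    (h : ∀ (w : Fin d → ℝ) (b : ℝ) (f : C(Ω, ℝ)), (∀ x : Ω, f x = ρ (w ⬝ᵥ (x : Fin d → ℝ) + b)) →
      f ∈ M) : M = ⊤ := by
  let L : (Fin d → ℝ) →+ C(Ω, ℝ) :=
    { toFun := fun w => ⟨fun x => w ⬝ᵥ (x : Fin d → ℝ), by fun_prop⟩
      map_zero' := by ext; simp
      map_add' := fun v w => by ext; simp [add_dotProduct] }
  refine eq_top_of_exp_mem hM L.range (fun x y hxy => ?_) ?_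
  · obtain ⟨i, hi⟩ := Function.ne_iff.1 (Subtype.coe_injective.ne hxy)
    exact ⟨L (Pi.single i 1), ⟨_, rfl⟩, by simpa [L] using hi⟩
  · rintro _ ⟨w, rfl⟩
    refine exp_mem_of_pow_mem hM (pow_mem_of_not_polynomial hM hρ fun a b => ?_)
    exact h (a • w) b _ fun x => by simp [affineComp_apply, L]

/-! ### Closures of network sets -/

/-- Networks are stable under postcomposition with scalar multiplications and translations. -/
theorem NeuralNetwork.exists_realization_eq_smul_add (ρ : ℝ → ℝ) {d m : ℕ} {N : List ℕ}
    (Φ : NeuralNetwork d N m) (a : ℝ) (c : Fin m → ℝ) :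
    ∃ Ψ : NeuralNetwork d N m, ∀ x, Ψ.realization ρ x = a • Φ.realization ρ x + c := by
  induction Φ with
  | output A b =>
    refine ⟨.output (a • A) (a • b + c), fun x => ?_⟩
    simp only [realization, Matrix.smul_mulVec, smul_add, add_assoc]
  | layer A b Φ ih =>
    obtain ⟨Ψ, hΨ⟩ := ih c
    exact ⟨.layer A b Ψ, fun x => hΨ _⟩

/-- The compositions of a map into the input space with the networks of a given architecture. -/
def realizationComp (ρ : ℝ → ℝ) {X : Type*} [TopologicalSpace X] {n : ℕ} (N : List ℕ)
    (F : X → Fin n → ℝ) : Set C(X, ℝ) :=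
  {f | ∃ Φ : NeuralNetwork n N 1, ∀ x, f x = Φ.realization ρ (F x) 0}

theorem realizationSet_eq (ρ : ℝ → ℝ) {d : ℕ} (N : List ℕ) (Ω : Set (Fin d → ℝ)) :
    realizationSet ρ N Ω = realizationComp ρ N ((↑) : Ω → Fin d → ℝ) := rfl

section Realizations

variable {ρ : ℝ → ℝ} {X : Type*} [TopologicalSpace X] [CompactSpace X] {n : ℕ}

theorem smul_add_const_mem_closure {N : List ℕ} {F : X → Fin n → ℝ} {f : C(X, ℝ)}
    (hf : f ∈ closure (realizationComp ρ N F)) (a c : ℝ) :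
    a • f + ContinuousMap.const X c ∈ closure (realizationComp ρ N F) := by
  refine map_mem_closure (f := fun f => a • f + ContinuousMap.const X c) (by fun_prop) hf ?_
  rintro f ⟨Φ, hΦ⟩
  obtain ⟨Ψ, hΨ⟩ := Φ.exists_realization_eq_smul_add ρ a fun _ => c
  exact ⟨Ψ, fun x => by simp [hΨ, hΦ]⟩

theorem smul_mem_closure {N : List ℕ} {F : X → Fin n → ℝ} {f : C(X, ℝ)}
    (hf : f ∈ closure (realizationComp ρ N F)) (a : ℝ) :
    a • f ∈ closure (realizationComp ρ N F) := by
  convert smul_add_const_mem_closure hf a 0 using 1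
  ext
  simp

open Filter Topology in
/-- The difference quotients of an activation function at a point of differentiability
approximate the identity uniformly on the values of `f`. -/
theorem tendsto_affineComp_differenceQuotient {ρ : C(ℝ, ℝ)} {x₀ c : ℝ} (h : HasDerivAt ρ c x₀)
    (f : C(X, ℝ)) :
    Tendsto (fun t : ℝ => t⁻¹ • (affineComp ρ f t x₀ - ContinuousMap.const X (ρ x₀)))
      (𝓝[≠] 0) (𝓝 (c • f)) := by
  rw [Metric.tendsto_nhds]
  intro ε hε
  have hK : 0 < ‖f‖ + 1 := by positivity
  have hlo := (hasDerivAt_iff_isLittleO_nhds_zero.1 h).def (c := ε / 2 / (‖f‖ + 1)) (by positivity)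
  obtain ⟨δ, hδ, hball⟩ := Metric.eventually_nhds_iff.1 hlo
  have hev : ∀ᶠ t : ℝ in 𝓝[≠] 0, dist t 0 < δ / (‖f‖ + 1) :=
    mem_nhdsWithin_of_mem_nhds (Metric.ball_mem_nhds _ (by positivity))
  filter_upwards [hev, self_mem_nhdsWithin] with t ht ht0
  have ht0 : 0 < |t| := abs_pos.2 ht0
  refine lt_of_le_of_lt ((ContinuousMap.dist_le (by positivity)).2 fun x => ?_) (half_lt_self hε)
  have hfx : |f x| ≤ ‖f‖ + 1 := (f.norm_coe_le_norm x).trans (by linarith)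
  have hsmall : |t| * |f x| < δ := by
    rw [Real.dist_0_eq_abs, lt_div_iff₀ hK] at ht
    exact (mul_le_mul_of_nonneg_left hfx ht0.le).trans_lt ht
  have hb := hball (y := t * f x) (by rwa [Real.dist_0_eq_abs, abs_mul])
  simp only [Real.norm_eq_abs, smul_eq_mul, abs_mul] at hb
  have hbound : ε / 2 / (‖f‖ + 1) * (|t| * |f x|) ≤ |t| * (ε / 2) := by
    calc ε / 2 / (‖f‖ + 1) * (|t| * |f x|) ≤ ε / 2 / (‖f‖ + 1) * (|t| * (‖f‖ + 1)) := by gcongr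
      _ = |t| * (ε / 2) := by field_simp
  have heq : (t⁻¹ • (affineComp ρ f t x₀ - ContinuousMap.const X (ρ x₀))) x - (c • f) x =
      t⁻¹ * (ρ (x₀ + t * f x) - ρ x₀ - t * f x * c) := by
    have : t ≠ 0 := abs_pos.1 ht0
    simp only [ContinuousMap.smul_apply, ContinuousMap.sub_apply, affineComp_apply,
      ContinuousMap.const_apply, smul_eq_mul, add_comm x₀]
    field_simp
  rw [Real.dist_eq, heq, abs_mul, abs_inv, inv_mul_le_iff₀ ht0]
  exact hb.trans hbound

open Filter Topology in
/-- Networks approximate the coordinate projection. -/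
theorem mem_closure_realizationComp_of_coordinate {ρ : C(ℝ, ℝ)} {x₀ : ℝ}
    (hd : DifferentiableAt ℝ ρ x₀) (hd0 : deriv ρ x₀ ≠ 0) {N : List ℕ} (hN : ∀ m ∈ N, 1 ≤ m) :
    ∀ {n : ℕ} (F : X → Fin n → ℝ) (i : Fin n) (f : C(X, ℝ)), (∀ x, f x = F x i) →
      f ∈ closure (realizationComp ρ N F) := by
  induction N with
  | nil =>
    intro n F i f hf
    refine subset_closure ⟨.output (fun _ => Pi.single i 1) 0, fun x => ?_⟩
    simp [NeuralNetwork.realization, Matrix.mulVec, hf]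
  | cons m N ih =>
    intro n F i f hf
    let j : Fin m := ⟨0, hN m (by simp)⟩
    have hlayer : ∀ t : ℝ, affineComp ρ f t x₀ ∈ closure (realizationComp ρ (m :: N) F) := by
      intro t
      -- All neurons of the layer compute the same function `ρ (t * f + x₀)`.
      let A : Matrix (Fin m) (Fin n) ℝ := fun _ => Pi.single i t
      let b : Fin m → ℝ := fun _ => x₀
      refine closure_mono ?_ (ih (fun k hk => hN k (by simp [hk]))
        (fun x k => ρ ((A.mulVec (F x) + b) k)) j (affineComp ρ f t x₀) fun x => ?_)
      · rintro g ⟨Φ, hΦ⟩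
        exact ⟨.layer A b Φ, hΦ⟩
      · simp [affineComp_apply, A, b, Matrix.mulVec, hf]
    have hlim := tendsto_affineComp_differenceQuotient hd.hasDerivAt f
    have hmem : deriv ρ x₀ • f ∈ closure (realizationComp ρ (m :: N) F) := by
      refine isClosed_closure.mem_of_tendsto hlim (Eventually.of_forall fun t => ?_)
      convert smul_add_const_mem_closure (hlayer t) t⁻¹ (-(t⁻¹ * ρ x₀)) using 1
      ext x
      simp
      ring
    simpa [smul_smul, hd0] using smul_mem_closure hmem (deriv ρ x₀)⁻¹

/-- The closure of the set of networks with at least one hidden layer contains the ridge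
functions. -/
theorem ridge_mem_closure_realizationComp {ρ : C(ℝ, ℝ)} {x₀ : ℝ}
    (hd : DifferentiableAt ℝ ρ x₀) (hd0 : deriv ρ x₀ ≠ 0) {m : ℕ} {N : List ℕ}
    (hN : ∀ k ∈ m :: N, 1 ≤ k) (F : X → Fin n → ℝ) (w : Fin n → ℝ) (b : ℝ) (f : C(X, ℝ))
    (hf : ∀ x, f x = ρ (w ⬝ᵥ F x + b)) : f ∈ closure (realizationComp ρ (m :: N) F) := by
  let A : Matrix (Fin m) (Fin n) ℝ := fun _ => w
  let c : Fin m → ℝ := fun _ => b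
  refine closure_mono ?_ (mem_closure_realizationComp_of_coordinate (N := N) hd hd0
    (fun k hk => hN k (by simp [hk])) (fun x k => ρ ((A.mulVec (F x) + c) k))
    ⟨0, hN m (by simp)⟩ f hf)
  rintro g ⟨Φ, hΦ⟩
  exact ⟨.layer A c Φ, hΦ⟩

end Realizations

/-! ### `ε`-convexity and the conclusion -/

/-- A closed set that is stable under scalar multiplication and `ε`-convex for some `ε > 0` is
stable under addition. -/
theorem IsEpsConvex.add_mem {Y : Type*} [NormedAddCommGroup Y] [NormedSpace ℝ Y] {ε : ℝ}
    {A : Set Y} (h : IsEpsConvex ε A) (hA : IsClosed A) (hsmul : ∀ (a : ℝ), ∀ y ∈ A, a • y ∈ A)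
    {y z : Y} (hy : y ∈ A) (hz : z ∈ A) : y + z ∈ A := by
  have key : ∀ n : ℕ, ∃ u ∈ A, dist u (y + z) ≤ ε * (1 / ((n : ℝ) + 1)) := by
    intro n
    have hn : (0 : ℝ) < n + 1 := by positivity
    have hmem : ((n : ℝ) + 1) • (y + z) ∈ convexHull ℝ A := by
      -- The point is the midpoint of `2(n + 1)y` and `2(n + 1)z`; dividing by `n + 1` afterwards
      -- shrinks the error to `ε / (n + 1)`.
      have := (convex_convexHull ℝ A) (subset_convexHull ℝ A (hsmul (2 * ((n : ℝ) + 1)) y hy))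
        (subset_convexHull ℝ A (hsmul (2 * ((n : ℝ) + 1)) z hz))
        (a := 1 / 2) (b := 1 / 2) (by norm_num) (by norm_num) (by norm_num)
      convert this using 1
      rw [smul_smul, smul_smul, smul_add]
      congr 2 <;> ring
    obtain ⟨u, hu, v, hv, huv⟩ := h hmem
    refine ⟨((n : ℝ) + 1)⁻¹ • u, hsmul _ _ hu, ?_⟩
    have : y + z = ((n : ℝ) + 1)⁻¹ • (u + v) := by
      rw [show u + v = _ from huv, inv_smul_smul₀ hn.ne']
    rw [this, dist_eq_norm, ← smul_sub, norm_smul, sub_add_cancel_left, norm_neg, norm_inv,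
      Real.norm_of_nonneg hn.le, mul_comm, one_div]
    gcongr
    exact (mem_ball_zero_iff.1 hv).le
  choose u hu hdist using key
  refine hA.mem_of_tendsto (b := Filter.atTop) (tendsto_iff_dist_tendsto_zero.2 ?_) (Filter.Eventually.of_forall hu)
  refine squeeze_zero (fun _ => dist_nonneg) hdist ?_
  simpa using tendsto_one_div_add_atTop_nhds_zero_nat.const_mul ε

/-- `C(Ω, ℝ)` carries the supremum norm, and the closure is taken in this space. -/
theorem theorem2p2 (d : ℕ) (hd : 1 ≤ d) (N : List ℕ) (hL : 2 ≤ N.length + 1)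
    (hN : ∀ n ∈ N, 1 ≤ n) (Ω : Set (Fin d → ℝ)) [CompactSpace Ω] (ρ : ℝ → ℝ)
    (hρ : Continuous ρ) (hpoly : ¬ ∃ p : ℝ[X], ∀ x : ℝ, ρ x = p.eval x)
    (hderiv : ∃ x₀ : ℝ, DifferentiableAt ℝ ρ x₀ ∧ deriv ρ x₀ ≠ 0)
    (hdense : ¬ Dense (realizationSet ρ N Ω)) :
    ¬ ∃ ε : ℝ, 0 < ε ∧ IsEpsConvex ε (closure (realizationSet ρ N Ω)) := by
  rintro ⟨ε, -, hε⟩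
  obtain ⟨x₀, hx₀, hx₀'⟩ := hderiv
  obtain ⟨m, N, rfl⟩ : ∃ m N', N = m :: N' :=
    List.exists_cons_of_ne_nil fun h => by simp [h] at hL
  rw [realizationSet_eq] at hε hdense
  have hridge := ridge_mem_closure_realizationComp (ρ := ⟨ρ, hρ⟩) hx₀ hx₀' hN ((↑) : Ω → Fin d → ℝ)
  let M : Submodule ℝ C(Ω, ℝ) :=
    { carrier := closure (realizationComp ρ (m :: N) ((↑) : Ω → Fin d → ℝ))
      add_mem' := hε.add_mem isClosed_closure fun a y hy => smul_mem_closure hy a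
      zero_mem' := by
        have := smul_mem_closure (hridge 0 0 (ContinuousMap.const Ω (ρ 0)) (by simp)) 0
        rwa [zero_smul] at this
      smul_mem' := fun a y hy => smul_mem_closure hy a }
  have hM : M = ⊤ := eq_top_of_ridge_mem (ρ := ⟨ρ, hρ⟩) isClosed_closure hpoly hridge
  refine hdense fun f => ?_
  have : f ∈ M := hM ▸ Submodule.mem_top
  exact this
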